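/- Let $w$ be a finite word, i.e. a finite sequence of letters from some alphabet. A factor of $w$ is a word $v$ with $w=uvy$ for some (possibly empty) words $u,y$. A border of a word is a proper prefix of it that is also a suffix of it. A word is closed if its length is at most $1$, or if its longest border occurs in it exactly twice (as a prefix and as a suffix). Let $\mathrm{cl}(w)$ be the number of distinct closed factors of $w$ (including the empty word and the letters), and let $\mathrm{cl}'(w)$ be the number of distinct closed factors of $w$ of length at least $2$. Theorem. For every finite word $w$ of length $n\ge 0$, $$\mathrm{cl}'(w)\le \frac{n^2}{6}+\frac{n}{6}\qquad\text{and}\qquad \mathrm{cl}(w)\le \frac{n^2}{6}+\frac{7n}{6}+1 .$$ -/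

import Mathlib

namespace ClosedWords

/-- `v` is a border of `w`: a proper prefix of `w` which is also a suffix of `w`. -/
def IsBorder {α : Type*} (v w : List α) : Prop :=
  v <+: w ∧ v ≠ w ∧ v <:+ w

/-- `v` is the longest border of `w`. -/
def IsLongestBorder {α : Type*} (v w : List α) : Prop :=
  IsBorder v w ∧ ∀ u : List α, IsBorder u w → u.length ≤ v.length

/-- The set of (starting positions of) occurrences of `v` in `w`. -/
def occurrences {α : Type*} (v w : List α) : Set ℕ :=
  {i | ∃ u y : List α, w = u ++ v ++ y ∧ u.length = i}

/-- `w` is closed: it is empty or a letter, or its longest border occurs in `w` exactly twice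
(these two occurrences are then the prefix and the suffix). -/
def IsClosedWord {α : Type*} (w : List α) : Prop :=
  w.length ≤ 1 ∨ ∃ v : List α, IsLongestBorder v w ∧ (occurrences v w).ncard = 2

/-- The set of distinct closed factors of `w`. -/
def closedFactors {α : Type*} (w : List α) : Set (List α) :=
  {v | v <:+: w ∧ IsClosedWord v}

/-- The set of distinct long closed factors of `w`, that is, those of length at least `2`. -/
def longClosedFactors {α : Type*} (w : List α) : Set (List α) :=
  {v | v ∈ closedFactors w ∧ 2 ≤ v.length}

/-- The number of distinct closed factors of `w`. -/
noncomputable def cl {α : Type*} (w : List α) : ℕ :=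
  (closedFactors w).ncard

/-- The number of distinct closed factors of `w` of length at least `2`. -/
noncomputable def clLong {α : Type*} (w : List α) : ℕ :=
  (longClosedFactors w).ncard

/-- A word has finitely many occurrences in another one, so counting them is meaningful. -/
theorem occurrences_finite {α : Type*} (v w : List α) : (occurrences v w).Finite := by
  refine (Set.finite_Iic w.length).subset ?_
  rintro i ⟨u, y, rfl, rfl⟩
  simp only [Set.mem_Iic, List.length_append]
  omega

/-- A word has finitely many closed factors, so counting them is meaningful. -/
theorem closedFactors_finite {α : Type*} (w : List α) : (closedFactors w).Finite := by
  refine (List.finite_toSet w.sublists).subset ?_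
  rintro v ⟨hv, -⟩
  exact List.mem_sublists.2 hv.sublist

/-- A word has finitely many closed factors of length at least `2`. -/
theorem longClosedFactors_finite {α : Type*} (w : List α) : (longClosedFactors w).Finite :=
  (closedFactors_finite w).subset fun _ hv => hv.1

end ClosedWords

/-!
Write `slack w = n (n + 1) - 6 * clLong w` for a word `w` of length `n`; the bound on `clLong` says
that the slack is nonnegative, and the bound on `cl` follows because at most `n + 1` factors have
length at most `1`.

Let `k = numNew w` be the number of long closed prefixes of `w` that do not occur again in `w`, and
`k'` the same number for the reversed word. Deleting the first letter changes the slack by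
`2 n - 6 k`, deleting the last one by `2 n - 6 k'`. The induction on length needs the stronger
statement `Good w`: the slack is also at least `s (s + 1)`, where `s = 3 max(k, k') - n - 1`, when
this is nonnegative.

* If `w` is not closed, let `k ≥ k'` by symmetry. A closed prefix of `w` is then a prefix of `w`
  without its last letter, so deleting that letter does not decrease `k`, and goodness passes from
  the two shorter words to `w` (`good_of_not_isReturn`).
* So if some word is not good, then some closed word is not. Among these choose one whose period `p`
  (its length minus that of its longest border) is least, and let `x` be its `p`-periodic
  extension to `ℤ`. Then every window of `x` that is not closed with period `p` is good. For windows
  closed with period `p`, extending by one letter inside `x` does not decrease `k` on the left or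
  `k'` on the right, so a window that is not good extends to one with negative slack
  (`IsReturn.exists_slack_window_neg`).
* Take a window of `x` with minimal slack, assumed negative. No deletion and no extension can
  decrease the slack; this forces its length to be `3 k - 1` or `3 k`, and then every shift of a
  window of either length is again minimal, with the same `k`. Counting closed prefixes in both
  lengths shows that at every position the factor of a certain length has first return exactly `k`,
  so `x` has period `k` and `k = p`. But the closed factors of a window of length `3 p - 1` can be
  counted directly, by starting position modulo `p` and border length, and its slack is nonnegative
  (`slack_window_nonneg_of_length_eq`). This contradiction is `slack_window_nonneg`.
-/

namespace ClosedWords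

variable {α : Type*}

/-! ### Closed words as complete returns -/

/-- `u` is a complete return with shift `q`: for some `m ≥ 1` with `u.length = q + m`, its prefix of
length `m` occurs in `u` at `0` and at `q`, and nowhere in between. These are the closed words of
length at least `2`; `m` is then the length of the longest border and `q` the least period. -/
def IsReturn (u : List α) (q : ℕ) : Prop :=
  ∃ m, 1 ≤ m ∧ 1 ≤ q ∧ u.length = q + m ∧ (∀ t < m, u[t]? = u[q + t]?) ∧
    ∀ r, 0 < r → r < q → ∃ t < m, u[t]? ≠ u[r + t]?

theorem mem_occurrences_iff {v w : List α} {i : ℕ} :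
    i ∈ occurrences v w ↔ i + v.length ≤ w.length ∧ ∀ t < v.length, v[t]? = w[i + t]? := by
  constructor
  · rintro ⟨u, y, rfl, rfl⟩
    refine ⟨by simp, fun t ht => ?_⟩
    rw [List.append_assoc, List.getElem?_append_right (by omega), Nat.add_sub_cancel_left,
      List.getElem?_append_left ht]
  · rintro ⟨h, hv⟩
    refine ⟨w.take i, w.drop (i + v.length), ?_, by simp; omega⟩
    have : v = (w.drop i).take v.length := by
      apply List.ext_getElem?
      intro t
      rcases lt_or_ge t v.length with ht | ht
      · rw [List.getElem?_take_of_lt ht, List.getElem?_drop, hv t ht]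
      · rw [List.getElem?_eq_none ht, List.getElem?_eq_none (by simp; omega)]
    conv_lhs => rw [← List.take_append_drop i w, ← List.take_append_drop v.length (w.drop i),
      ← this, List.drop_drop]
    simp

theorem isClosedWord_iff_isReturn {u : List α} :
    (IsClosedWord u ∧ 2 ≤ u.length) ↔ ∃ q, IsReturn u q := by
  constructor
  · rintro ⟨h | ⟨v, ⟨⟨hp, hne, hs⟩, -⟩, hc⟩, h2⟩
    · omega
    have hlt : v.length < u.length :=
      lt_of_le_of_ne hp.length_le fun h => hne (hp.eq_of_length h)
    have h0 : 0 ∈ occurrences v u := by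
      obtain ⟨y, rfl⟩ := hp
      exact ⟨[], y, by simp, rfl⟩
    have hq : u.length - v.length ∈ occurrences v u := by
      obtain ⟨y, rfl⟩ := hs
      exact ⟨y, [], by simp, by simp⟩
    have key : ∀ r ∈ occurrences v u, r = 0 ∨ r = u.length - v.length := by
      intro r hr
      by_contra hcon
      push Not at hcon
      have hsub : ({0, u.length - v.length, r} : Finset ℕ) ⊆ (occurrences_finite v u).toFinset := by
        intro z hz
        simp only [Finset.mem_insert, Finset.mem_singleton] at hz
        rcases hz with rfl | rfl | rfl <;> simpa
      have := Finset.card_le_card hsub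
      rw [← Set.ncard_eq_toFinset_card _ (occurrences_finite v u), hc,
        Finset.card_eq_three.2 ⟨_, _, _, by omega, hcon.1.symm, hcon.2.symm, rfl⟩] at this
      omega
    have hm : 1 ≤ v.length := by
      by_contra hm
      have := key 1 (mem_occurrences_iff.2 ⟨by omega, fun t ht => by omega⟩)
      omega
    rw [mem_occurrences_iff] at h0 hq
    refine ⟨u.length - v.length, v.length, hm, by omega, by omega, fun t ht => ?_,
      fun r hr0 hrq => ?_⟩
    · rw [← hq.2 t ht, h0.2 t ht, zero_add]
    · by_contra! hcon
      have := key r (mem_occurrences_iff.2 ⟨by omega, fun t ht => by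
        rw [← hcon t ht, h0.2 t ht, zero_add]⟩)
      omega
  · rintro ⟨q, m, hm, hq, hlen, hb, hr⟩
    have hlv : (u.take m).length = m := by simp; omega
    have hget : ∀ t < m, (u.take m)[t]? = u[t]? := fun t ht => List.getElem?_take_of_lt ht
    have hocc : occurrences (u.take m) u = {0, q} := by
      ext r
      rw [mem_occurrences_iff, hlv]
      constructor
      · rintro ⟨h1, h2⟩
        by_contra hcon
        simp only [Set.mem_insert_iff, Set.mem_singleton_iff, not_or] at hcon
        obtain ⟨t, ht, h⟩ := hr r (by omega) (by omega)
        exact h (by rw [← h2 t ht, hget t ht])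
      · rintro (rfl | rfl)
        · exact ⟨by omega, fun t ht => by rw [hget t ht, zero_add]⟩
        · exact ⟨by omega, fun t ht => by rw [hget t ht, hb t ht]⟩
    refine ⟨Or.inr ⟨u.take m, ⟨⟨List.take_prefix _ _, fun h => ?_, ?_⟩, ?_⟩, ?_⟩, by omega⟩
    · have := congrArg List.length h
      omega
    · have : q ∈ occurrences (u.take m) u := by simp [hocc]
      obtain ⟨a, y, h, ha⟩ := this
      have hy : y = [] := by
        have := congrArg List.length h
        simp only [List.length_append, hlv] at this
        exact List.length_eq_zero_iff.1 (by omega)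
      rw [hy, List.append_nil] at h
      exact ⟨a, h.symm⟩
    · rintro v ⟨hp, hne, y, hy⟩
      by_contra! hcon
      rw [hlv] at hcon
      have hlt : v.length < u.length :=
        lt_of_le_of_ne hp.length_le fun h => hne (hp.eq_of_length h)
      have hyl := congrArg List.length hy
      rw [List.length_append] at hyl
      have hv0 : v.length ≠ u.length := hlt.ne
      obtain ⟨t, ht, h⟩ := hr y.length (by omega) (by omega)
      apply h
      obtain ⟨z, hz⟩ := hp
      have e1 : u[t]? = v[t]? := by
        rw [← hz, List.getElem?_append_left (by omega)]
      have e2 : u[y.length + t]? = v[t]? := by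
        rw [← hy, List.getElem?_append_right (by omega), Nat.add_sub_cancel_left]
      rw [e1, e2]
    · rw [hocc, Set.ncard_pair (by omega)]

theorem IsReturn.reverse {u : List α} {q : ℕ} (h : IsReturn u q) : IsReturn u.reverse q := by
  obtain ⟨m, hm, hq, hlen, hb, hr⟩ := h
  have hrev : ∀ i < u.length, u.reverse[i]? = u[u.length - 1 - i]? := fun i hi =>
    List.getElem?_reverse hi
  refine ⟨m, hm, hq, by simpa, fun t ht => ?_, fun r h0 hrq => ?_⟩
  · rw [hrev _ (by omega), hrev _ (by omega)]
    have := hb (m - 1 - t) (by omega)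
    rw [show u.length - 1 - (q + t) = m - 1 - t by omega, this]
    congr 1; omega
  · obtain ⟨t, ht, h⟩ := hr (q - r) (by omega) (by omega)
    refine ⟨m - 1 - t, by omega, ?_⟩
    rw [hrev _ (by omega), hrev _ (by omega),
      show u.length - 1 - (m - 1 - t) = q + t by omega,
      show u.length - 1 - (r + (m - 1 - t)) = q - r + t by omega, ← hb t ht]
    exact h

theorem mem_longClosedFactors_iff {v w : List α} :
    v ∈ longClosedFactors w ↔ v <:+: w ∧ ∃ q, IsReturn v q := by
  rw [← isClosedWord_iff_isReturn]
  simp only [longClosedFactors, closedFactors, Set.mem_ofPred_eq, and_assoc]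

/-! ### Slack and goodness -/

theorem clLong_reverse (w : List α) : clLong w.reverse = clLong w := by
  have : longClosedFactors w.reverse = List.reverse '' longClosedFactors w := by
    ext v
    simp only [Set.mem_image, mem_longClosedFactors_iff]
    constructor
    · rintro ⟨h, q, hq⟩
      exact ⟨v.reverse, ⟨by rwa [← List.reverse_infix, List.reverse_reverse], q, hq.reverse⟩,
        List.reverse_reverse v⟩
    · rintro ⟨u, ⟨h, q, hq⟩, rfl⟩
      exact ⟨List.reverse_infix.2 h, q, hq.reverse⟩
  rw [clLong, this, Set.ncard_image_of_injective _ List.reverse_injective, clLong]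

/-- The long closed prefixes of `w` that have no other occurrence in `w`. -/
def newPrefixes (w : List α) : Set (List α) :=
  {v | v <+: w ∧ (∃ q, IsReturn v q) ∧ ¬ v <:+: w.tail}

/-- The number of long closed factors that are lost when the first letter of `w` is deleted. -/
noncomputable def numNew (w : List α) : ℕ := (newPrefixes w).ncard

theorem newPrefixes_finite (w : List α) : (newPrefixes w).Finite :=
  (longClosedFactors_finite w).subset fun _ hv =>
    mem_longClosedFactors_iff.2 ⟨hv.1.isInfix, hv.2.1⟩

theorem clLong_eq (w : List α) : clLong w = numNew w + clLong w.tail := by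
  have : longClosedFactors w = newPrefixes w ∪ longClosedFactors w.tail := by
    ext v
    simp only [Set.mem_union, mem_longClosedFactors_iff, newPrefixes, Set.mem_ofPred_eq]
    cases w with
    | nil =>
      simp only [List.tail_nil, List.infix_nil, List.prefix_nil]
      tauto
    | cons a w =>
      rw [List.infix_cons_iff, List.tail_cons]
      tauto
  rw [clLong, this, Set.ncard_union_eq ?_ (newPrefixes_finite w) (longClosedFactors_finite _)]
  · rfl
  · rw [Set.disjoint_left]
    exact fun v hv hv' => hv.2.2 (mem_longClosedFactors_iff.1 hv').1

/-- Six times the gap in the bound on `clLong w`, as an integer that may a priori be negative. -/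
noncomputable def slack (w : List α) : ℤ := w.length * (w.length + 1) - 6 * clLong w

theorem slack_reverse (w : List α) : slack w.reverse = slack w := by
  simp [slack, clLong_reverse]

theorem slack_eq_tail {w : List α} (hw : w ≠ []) :
    slack w = slack w.tail + 2 * w.length - 6 * numNew w := by
  have h : ((w.tail.length : ℕ) : ℤ) = w.length - 1 := by
    have := List.length_pos_iff.2 hw
    rw [List.length_tail]; omega
  rw [slack, slack, clLong_eq w, h]
  push_cast
  ring

theorem slack_eq_dropLast {w : List α} (hw : w ≠ []) :
    slack w = slack w.dropLast + 2 * w.length - 6 * numNew w.reverse := by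
  rw [← slack_reverse w, slack_eq_tail (by simpa), List.tail_reverse, slack_reverse,
    List.length_reverse]

/-- The strengthening of `0 ≤ slack w` that carries the induction on length. The condition on `s` is
`s ≤ 3 max(k, k') - n - 1`, written without subtraction. -/
def Good (w : List α) : Prop :=
  0 ≤ slack w ∧ ∀ s : ℕ, s + w.length + 1 ≤ 3 * max (numNew w) (numNew w.reverse) →
    (s * (s + 1) : ℤ) ≤ slack w

theorem Good.reverse {w : List α} (h : Good w) : Good w.reverse := by
  unfold Good at *
  rwa [slack_reverse, List.length_reverse, List.reverse_reverse, max_comm]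

/-- The only prefix lost with the last letter is `w` itself, which is not closed; and a shorter word
leaves fewer places for a second occurrence. -/
theorem numNew_le_dropLast {w : List α} (h : ¬ ∃ q, IsReturn w q) :
    numNew w ≤ numNew w.dropLast := by
  refine Set.ncard_le_ncard ?_ (newPrefixes_finite _)
  rintro v ⟨hp, hv, hn⟩
  refine ⟨?_, hv, fun hi => hn (hi.trans ?_)⟩
  · rw [List.prefix_iff_eq_take, List.dropLast_eq_take, List.take_take, min_eq_left]
    · exact List.prefix_iff_eq_take.1 hp
    · have : v.length ≠ w.length := fun e => h (hp.eq_of_length e ▸ hv)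
      have := hp.length_le
      omega
  · rw [List.tail_dropLast]
    exact (List.dropLast_prefix _).isInfix

/-- Goodness passes to a non-closed word from the words obtained by deleting its first or its last
letter. -/
theorem good_of_not_isReturn {w : List α} (hw : w ≠ []) (h : ¬ ∃ q, IsReturn w q)
    (ht : Good w.tail) (hd : Good w.dropLast) : Good w := by
  wlog hk : numNew w.reverse ≤ numNew w generalizing w
  · have := this (w := w.reverse) (by simpa) (fun ⟨q, hq⟩ => h ⟨q, by simpa using hq.reverse⟩)
      (by simpa [List.tail_reverse] using hd.reverse)
      (by simpa [List.dropLast_reverse] using ht.reverse) (by simpa using (not_le.1 hk).le)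
    simpa using this.reverse
  have e1 := slack_eq_tail hw
  have e2 := slack_eq_dropLast hw
  have h3 := numNew_le_dropLast h
  have hl := List.length_pos_iff.2 hw
  have hld : w.dropLast.length = w.length - 1 := List.length_dropLast
  -- Deleting the last letter raises the largest admissible `s` from `S` to at least `S + 1` and
  -- costs at most `2 (S + 1)`, the difference of `(S + 1) (S + 2)` and `S (S + 1)`.
  have key : ∀ s : ℕ, s + w.length + 1 ≤ 3 * numNew w → (s * (s + 1) : ℤ) ≤ slack w := by
    intro s hs
    obtain ⟨S, hS⟩ : ∃ S, S + w.length + 1 = 3 * numNew w := ⟨3 * numNew w - w.length - 1, by omega⟩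
    have h4 := hd.2 (S + 1) (by
      have := le_max_left (numNew w.dropLast) (numNew w.dropLast.reverse)
      rw [hld]
      omega)
    have hsS : (s : ℤ) ≤ S := by omega
    have hS' : (S : ℤ) + w.length + 1 = 3 * numNew w := by exact_mod_cast hS
    have hk' : (numNew w.reverse : ℤ) ≤ numNew w := by exact_mod_cast hk
    push_cast at h4
    nlinarith
  refine ⟨?_, fun s hs => key s (by rwa [max_eq_left hk] at hs)⟩
  by_cases h5 : 3 * numNew w ≤ w.length
  · have := ht.1
    zify at h5
    linarith
  · have := key 0 (by omega)
    simpa using this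

/-! ### Windows of a bi-infinite word -/

/-- The factor of length `n` at position `a` of the bi-infinite word `x`. -/
def window (x : ℤ → α) (a : ℤ) (n : ℕ) : List α :=
  (List.range n).map fun t : ℕ => x (a + t)

@[simp]
theorem length_window (x : ℤ → α) (a : ℤ) (n : ℕ) : (window x a n).length = n := by
  simp [window]

theorem getElem?_window (x : ℤ → α) (a : ℤ) {n t : ℕ} (h : t < n) :
    (window x a n)[t]? = some (x (a + t)) := by
  simp [window, h]

/-- The factors of length `m` of `x` at positions `i` and `j` are equal. -/
def Agree (x : ℤ → α) (i j : ℤ) (m : ℕ) : Prop :=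
  ∀ t : ℕ, t < m → x (i + t) = x (j + t)

theorem Agree.mono {x : ℤ → α} {i j : ℤ} {m m' : ℕ} (h : Agree x i j m) (hm : m' ≤ m) :
    Agree x i j m' :=
  fun t ht => h t (ht.trans_le hm)

theorem window_eq_window_iff {x y : ℤ → α} {a b : ℤ} {m n : ℕ} :
    window x a m = window y b n ↔ m = n ∧ ∀ t : ℕ, t < m → x (a + t) = y (b + t) := by
  constructor
  · intro h
    obtain rfl : m = n := by simpa using congrArg List.length h
    refine ⟨rfl, fun t ht => ?_⟩
    have := congrArg (fun l : List α => l[t]?) h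
    simpa only [getElem?_window _ _ ht, Option.some_inj] using this
  · rintro ⟨rfl, h⟩
    exact List.map_congr_left fun t ht => h t (List.mem_range.1 ht)

theorem take_window (x : ℤ → α) (a : ℤ) {m n : ℕ} (h : m ≤ n) :
    (window x a n).take m = window x a m := by
  rw [window, ← List.map_take, List.take_range, min_eq_left h, window]

theorem drop_window (x : ℤ → α) (a : ℤ) (i n : ℕ) :
    (window x a n).drop i = window x (a + i) (n - i) := by
  apply List.ext_getElem?
  intro t
  rw [List.getElem?_drop]
  rcases lt_or_ge t (n - i) with h | h
  · rw [getElem?_window _ _ h, getElem?_window _ _ (by omega)]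
    push_cast
    rw [add_assoc]
  · rw [List.getElem?_eq_none (by simp; omega), List.getElem?_eq_none (by simp; omega)]

theorem tail_window (x : ℤ → α) (a : ℤ) (n : ℕ) :
    (window x a n).tail = window x (a + 1) (n - 1) := by
  rw [← List.drop_one, drop_window, Nat.cast_one]

theorem dropLast_window (x : ℤ → α) (a : ℤ) (n : ℕ) :
    (window x a n).dropLast = window x a (n - 1) := by
  rw [List.dropLast_eq_take, length_window, take_window _ _ (Nat.sub_le n 1)]

theorem reverse_window (x : ℤ → α) (a : ℤ) (n : ℕ) :
    (window x a n).reverse = window (fun i => x (-i)) (1 - a - n) n := by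
  apply List.ext_getElem?
  intro t
  rcases lt_or_ge t n with h | h
  · rw [List.getElem?_reverse (by simpa), length_window, getElem?_window _ _ h,
      getElem?_window _ _ (by omega)]
    congr 2
    omega
  · rw [List.getElem?_eq_none (by simpa), List.getElem?_eq_none (by simpa)]

theorem prefix_window_iff {x : ℤ → α} {a : ℤ} {n : ℕ} {v : List α} :
    v <+: window x a n ↔ ∃ m ≤ n, v = window x a m := by
  constructor
  · intro h
    have hl : v.length ≤ n := by simpa using h.length_le
    exact ⟨v.length, hl, by rw [← take_window x a hl]; exact List.prefix_iff_eq_take.1 h⟩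
  · rintro ⟨m, hm, rfl⟩
    rw [← take_window x a hm]
    exact List.take_prefix _ _

theorem infix_window_iff {x : ℤ → α} {a : ℤ} {n : ℕ} {v : List α} :
    v <:+: window x a n ↔ ∃ i m : ℕ, i + m ≤ n ∧ v = window x (a + i) m := by
  rw [List.infix_iff_prefix_suffix]
  constructor
  · rintro ⟨t, hv, ht⟩
    rw [List.suffix_iff_eq_drop, length_window, drop_window] at ht
    have hl : t.length ≤ n := by
      have := congrArg List.length ht
      simp at this
      omega
    rw [ht, prefix_window_iff] at hv
    obtain ⟨m, hm, hv⟩ := hv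
    exact ⟨_, m, by omega, hv⟩
  · rintro ⟨i, m, h, rfl⟩
    exact ⟨(window x a n).drop i, by
      rw [drop_window]; exact prefix_window_iff.2 ⟨m, by omega, rfl⟩, List.drop_suffix _ _⟩

/-- The distance from `a` to the next occurrence of the factor of length `m` at `a`; it is the junk
value `0` if there is none, which cannot happen in a periodic word. -/
noncomputable def firstReturn (x : ℤ → α) (a : ℤ) (m : ℕ) : ℕ :=
  sInf {q | 1 ≤ q ∧ Agree x a (a + q) m}

theorem firstReturn_le {x : ℤ → α} {a : ℤ} {m q : ℕ} (hq : 1 ≤ q) (h : Agree x a (a + q) m) :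
    firstReturn x a m ≤ q :=
  Nat.sInf_le ⟨hq, h⟩

/-! ### Periodic words -/

section Periodic

variable {x : ℤ → α} {p : ℕ}

theorem agree_period (hx : Function.Periodic x p) (a : ℤ) (m : ℕ) : Agree x a (a + p) m :=
  fun t _ => by rw [add_right_comm, hx]

theorem firstReturn_le_period (hp : 1 ≤ p) (hx : Function.Periodic x p) (a : ℤ) (m : ℕ) :
    firstReturn x a m ≤ p :=
  firstReturn_le hp (agree_period hx a m)

theorem firstReturn_spec (hp : 1 ≤ p) (hx : Function.Periodic x p) (a : ℤ) (m : ℕ) :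
    1 ≤ firstReturn x a m ∧ Agree x a (a + firstReturn x a m) m :=
  Nat.sInf_mem (s := {q | 1 ≤ q ∧ Agree x a (a + q) m}) ⟨p, hp, agree_period hx a m⟩

theorem firstReturn_mono (hp : 1 ≤ p) (hx : Function.Periodic x p) (a : ℤ) {m m' : ℕ}
    (h : m ≤ m') : firstReturn x a m ≤ firstReturn x a m' :=
  firstReturn_le (firstReturn_spec hp hx a m').1 ((firstReturn_spec hp hx a m').2.mono h)

/-- If a factor extended by one letter to the left recurs at some distance, so does the factor. -/
theorem firstReturn_le_sub_one (hp : 1 ≤ p) (hx : Function.Periodic x p) (a : ℤ) (m : ℕ) :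
    firstReturn x a m ≤ firstReturn x (a - 1) (m + 1) := by
  obtain ⟨h1, h2⟩ := firstReturn_spec hp hx (a - 1) (m + 1)
  refine firstReturn_le h1 fun t ht => ?_
  have := h2 (t + 1) (by omega)
  push_cast at this
  convert this using 2 <;> ring

theorem isReturn_window_iff (hp : 1 ≤ p) (hx : Function.Periodic x p) {a : ℤ} {n q : ℕ} :
    IsReturn (window x a n) q ↔ ∃ m, 1 ≤ m ∧ n = q + m ∧ q = firstReturn x a m := by
  constructor
  · rintro ⟨m, hm, hq, hlen, hb, hr⟩
    rw [length_window] at hlen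
    obtain ⟨h1, h2⟩ := firstReturn_spec hp hx a m
    have hle : firstReturn x a m ≤ q := firstReturn_le hq fun t ht => by
      have := hb t ht
      rw [getElem?_window _ _ (by omega), getElem?_window _ _ (by omega), Option.some_inj] at this
      rw [this]
      push_cast
      rw [add_assoc]
    refine ⟨m, hm, hlen, le_antisymm (not_lt.1 fun hlt => ?_) hle⟩
    obtain ⟨t, ht, h⟩ := hr _ h1 hlt
    rw [getElem?_window _ _ (by omega), getElem?_window _ _ (by omega), h2 t ht] at h
    push_cast at h
    exact h (by rw [add_assoc])
  · rintro ⟨m, hm, rfl, hq⟩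
    obtain ⟨h1, h2⟩ := firstReturn_spec hp hx a m
    rw [← hq] at h1 h2
    refine ⟨m, hm, h1, by simp, fun t ht => ?_, fun r hr0 hrq => ?_⟩
    · rw [getElem?_window _ _ (by omega), getElem?_window _ _ (by omega), h2 t ht]
      push_cast
      rw [add_assoc]
    · by_contra! hcon
      refine absurd (firstReturn_le (x := x) (a := a) (m := m) hr0 fun t ht => ?_) (by omega)
      have := hcon t ht
      rw [getElem?_window _ _ (by omega), getElem?_window _ _ (by omega), Option.some_inj] at this
      rw [this]
      push_cast
      rw [add_assoc]

/-- In a window closed with period `p` and border of length `l`, a prefix recurs exactly when its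
length is at most `l`. Its closed prefixes have length `m + firstReturn x a m` for `m ≤ l`, and this
is strictly increasing in `m`. -/
theorem numNew_window (hp : 1 ≤ p) (hx : Function.Periodic x p) {a : ℤ} {l : ℕ}
    (h : firstReturn x a l = p) :
    numNew (window x a (p + l)) =
      ((Finset.Icc 1 l).filter fun m => l < m + firstReturn x a m).card := by
  have heq : newPrefixes (window x a (p + l)) =
      (fun m => window x a (m + firstReturn x a m)) ''
        ((Finset.Icc 1 l).filter fun m => l < m + firstReturn x a m : Finset ℕ) := by
    ext v
    simp only [newPrefixes, Set.mem_ofPred_eq, Set.mem_image, Finset.coe_filter, Finset.mem_Icc]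
    have hinf : ∀ L ≤ p + l, (window x a L <:+: (window x a (p + l)).tail ↔ L ≤ l) := by
      intro L hL
      rw [tail_window, infix_window_iff]
      constructor
      · rintro ⟨i, m, him, he⟩
        obtain ⟨rfl, hag⟩ := window_eq_window_iff.1 he
        by_contra! hlt
        have := firstReturn_le (x := x) (a := a) (m := l) (q := i + 1) (by omega) fun t ht => by
          rw [hag t (by omega)]
          push_cast
          congr 1
          ring
        omega
      · intro hLl
        refine ⟨p - 1, L, by omega, window_eq_window_iff.2 ⟨rfl, ?_⟩⟩
        have := agree_period hx a L
        rwa [show a + 1 + ((p - 1 : ℕ) : ℤ) = a + p by omega]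
    constructor
    · rintro ⟨hv, ⟨q, hq⟩, hn⟩
      obtain ⟨L, hL, rfl⟩ := prefix_window_iff.1 hv
      rw [hinf L hL] at hn
      obtain ⟨m, hm, rfl, hqm⟩ := (isReturn_window_iff hp hx).1 hq
      have hml : m ≤ l := by
        by_contra! hlt
        have := firstReturn_mono hp hx a hlt.le
        omega
      exact ⟨m, ⟨⟨hm, hml⟩, by omega⟩, by rw [← hqm, add_comm]⟩
    · rintro ⟨m, ⟨⟨hm, hml⟩, hlt⟩, rfl⟩
      have hle := firstReturn_le_period hp hx a m
      exact ⟨prefix_window_iff.2 ⟨_, by omega, rfl⟩,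
        ⟨_, (isReturn_window_iff hp hx).2 ⟨m, hm, add_comm _ _, rfl⟩⟩,
        by rw [hinf _ (by omega)]; omega⟩
  rw [numNew, heq, Set.InjOn.ncard_image, Set.ncard_coe_finset]
  intro m _ m' _ he
  have he := (window_eq_window_iff.1 he).1
  rcases lt_trichotomy m m' with hlt | rfl | hlt
  · have := firstReturn_mono hp hx a hlt.le
    omega
  · rfl
  · have := firstReturn_mono hp hx a hlt.le
    omega

/-- The border lengths counted by `numNew_window` form an upper segment of `[1, l]`, so they are the
last `numNew` ones. -/
theorem lt_add_firstReturn_iff (hp : 1 ≤ p) (hx : Function.Periodic x p) {a : ℤ} {l : ℕ}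
    (h : firstReturn x a l = p) {m : ℕ} (hm : 1 ≤ m) (hml : m ≤ l) :
    l < m + firstReturn x a m ↔ l < m + numNew (window x a (p + l)) := by
  rw [numNew_window hp hx h]
  set S := (Finset.Icc 1 l).filter fun m => l < m + firstReturn x a m with hS
  have hup : ∀ j ∈ S, ∀ j' ≤ l, j ≤ j' → j' ∈ S := by
    intro j hj j' hj' hjj
    rw [hS, Finset.mem_filter, Finset.mem_Icc] at hj ⊢
    have := firstReturn_mono hp hx a hjj
    omega
  have hmem : m ∈ S ↔ l < m + firstReturn x a m := by
    rw [hS, Finset.mem_filter, Finset.mem_Icc]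
    tauto
  rw [← hmem]
  constructor
  · intro hmS
    have := Finset.card_le_card (s := Finset.Icc m l) (t := S) fun j hj => by
      rw [Finset.mem_Icc] at hj
      exact hup m hmS j hj.2 hj.1
    rw [Nat.card_Icc] at this
    omega
  · intro hlt
    by_contra hmS
    have := Finset.card_le_card (s := S) (t := Finset.Ioc m l) fun j hj => by
      rw [Finset.mem_Ioc]
      refine ⟨not_le.1 fun hjm => hmS (hup j hj m hml hjm), ?_⟩
      rw [hS, Finset.mem_filter, Finset.mem_Icc] at hj
      exact hj.1.2
    rw [Nat.card_Ioc] at this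
    omega

/-- First returns are at most `p`, so only the last `p` border lengths can count. -/
theorem numNew_window_le_period (hp : 1 ≤ p) (hx : Function.Periodic x p) {a : ℤ} {n : ℕ}
    (h : IsReturn (window x a n) p) : numNew (window x a n) ≤ p := by
  obtain ⟨l, hl, rfl, hr⟩ := (isReturn_window_iff hp hx).1 h
  rw [numNew_window hp hx hr.symm]
  calc _ ≤ (Finset.Ioc (l - p) l).card := Finset.card_le_card fun m hm => by
        rw [Finset.mem_filter, Finset.mem_Icc] at hm
        have := firstReturn_le_period hp hx a m
        rw [Finset.mem_Ioc]
        omega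
    _ ≤ p := by rw [Nat.card_Ioc]; omega

/-- Extending a window that is closed with period `p` to the left inside `x` keeps it so and does
not decrease `numNew`: a border length `m` that counts yields `m + 1`. -/
theorem IsReturn.window_extend_left (hp : 1 ≤ p) (hx : Function.Periodic x p) {a : ℤ} {n : ℕ}
    (h : IsReturn (window x a n) p) :
    IsReturn (window x (a - 1) (n + 1)) p ∧
      numNew (window x a n) ≤ numNew (window x (a - 1) (n + 1)) := by
  obtain ⟨l, hl, rfl, hr⟩ := (isReturn_window_iff hp hx).1 h
  have hr' : firstReturn x (a - 1) (l + 1) = p :=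
    le_antisymm (firstReturn_le_period hp hx _ _)
      (hr.le.trans (firstReturn_le_sub_one hp hx a l))
  refine ⟨(isReturn_window_iff hp hx).2 ⟨l + 1, by omega, by omega, hr'.symm⟩, ?_⟩
  rw [add_assoc, numNew_window hp hx hr.symm, numNew_window hp hx hr']
  refine Finset.card_le_card_of_injOn (· + 1) (fun m hm => ?_) fun _ _ _ _ h => Nat.succ_injective h
  simp only [Finset.coe_filter, Finset.mem_Icc, Set.mem_ofPred_eq] at hm ⊢
  have := firstReturn_le_sub_one hp hx a m
  omega

theorem IsReturn.window_extend_right (hp : 1 ≤ p) (hx : Function.Periodic x p) {a : ℤ} {n : ℕ}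
    (h : IsReturn (window x a n) p) :
    IsReturn (window x a (n + 1)) p ∧
      numNew (window x a n).reverse ≤ numNew (window x a (n + 1)).reverse := by
  have hx' : Function.Periodic (fun i => x (-i)) p := fun i => by
    simpa using (hx (-(i + p))).symm
  have h' := h.reverse
  rw [reverse_window] at h'
  have := h'.window_extend_left hp hx'
  rw [show 1 - a - (n : ℤ) - 1 = 1 - a - ((n + 1 : ℕ) : ℤ) by push_cast; ring,
    ← reverse_window, ← reverse_window] at this
  exact ⟨by simpa using this.1.reverse, this.2⟩

/-- A factor of length at least `p` that recurs at distance `q` makes `q` a period of `x`. -/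
theorem periodic_of_agree (hp : 1 ≤ p) (hx : Function.Periodic x p) {a : ℤ} {m q : ℕ}
    (hm : p ≤ m) (h : Agree x a (a + q) m) : Function.Periodic x q := by
  intro i
  have h1 := Int.emod_nonneg (i - a) (show (p : ℤ) ≠ 0 by omega)
  have h2 := Int.emod_lt_of_pos (i - a) (show (0 : ℤ) < p by omega)
  have h3 := Int.emod_add_mul_ediv (i - a) p
  have h4 := h ((i - a) % p).toNat (by omega)
  rw [Int.toNat_of_nonneg h1] at h4
  have e : ∀ j, x j = x (j + (i - a) / p * p) := fun j => (hx.int_mul _ j).symm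
  rw [e, e (a + q + _)] at h4
  rw [show i + q = a + q + (i - a) % p + (i - a) / p * p by linarith, ← h4]
  congr 1
  linarith

/-- A closed factor is determined by its starting position `i` modulo `p` and the length `m` of its
longest border. If `m ≥ p` the first return is `p`, so `i + m + p ≤ 3 * p - 1`; hence in all cases
`m ≤ 2 * p - 1 - i`. -/
theorem slack_window_nonneg_of_length_eq (hp : 1 ≤ p) (hx : Function.Periodic x p)
    (hmin : ∀ g : ℕ, 1 ≤ g → Function.Periodic x g → p ≤ g) (a : ℤ) :
    0 ≤ slack (window x a (3 * p - 1)) := by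
  set S : Finset (Σ _ : ℕ, ℕ) := (Finset.range p).sigma fun i => Finset.Icc 1 (2 * p - 1 - i)
    with hS
  have hsub : longClosedFactors (window x a (3 * p - 1)) ⊆
      (fun z : Σ _ : ℕ, ℕ => window x (a + z.1) (firstReturn x (a + z.1) z.2 + z.2)) ''
        (S : Set (Σ _ : ℕ, ℕ)) := by
    intro v hv
    obtain ⟨hv, q, hq⟩ := mem_longClosedFactors_iff.1 hv
    obtain ⟨i, L, hiL, rfl⟩ := infix_window_iff.1 hv
    have hi : window x (a + i) L = window x (a + (i % p : ℕ)) L := by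
      have := hx.nat_mul (i / p)
      refine window_eq_window_iff.2 ⟨rfl, fun t _ => ?_⟩
      rw [← this (a + (i % p : ℕ) + t)]
      congr 1
      have := Nat.mod_add_div i p
      zify at this ⊢
      linarith
    have hip := Nat.mod_lt i hp
    have hii := Nat.mod_le i p
    rw [hi] at hq ⊢
    obtain ⟨m, hm, rfl, hqm⟩ := (isReturn_window_iff hp hx).1 hq
    refine ⟨⟨i % p, m⟩, ?_, by simp only [← hqm]⟩
    simp only [hS, Finset.coe_sigma, Set.mem_sigma_iff, Finset.mem_coe, Finset.mem_range,
      Finset.mem_Icc]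
    refine ⟨hip, hm, ?_⟩
    rcases lt_or_ge m p with hmp | hmp
    · omega
    · obtain ⟨h1, h2⟩ := firstReturn_spec hp hx (a + (i % p : ℕ)) m
      have := hmin _ h1 (periodic_of_agree hp hx hmp h2)
      omega
  have hcard : clLong (window x a (3 * p - 1)) ≤ S.card :=
    (Set.ncard_le_ncard hsub (S.finite_toSet.image _)).trans
      ((Set.ncard_image_le S.finite_toSet).trans (Set.ncard_coe_finset S).le)
  have hScard : (2 * S.card : ℤ) = p * (3 * p - 1) := by
    have e1 : S.card = ∑ i ∈ Finset.range p, (2 * p - 1 - i) := by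
      simp [hS, Finset.card_sigma]
    have e2 : ∀ k ≤ p, 2 * ∑ i ∈ Finset.range k, ((2 * p - 1 - i : ℕ) : ℤ)
        = k * (4 * p - 1 - k) := by
      intro k
      induction k with
      | zero => simp
      | succ k ih =>
        intro hk
        rw [Finset.sum_range_succ, mul_add, ih (by omega),
          show ((2 * p - 1 - k : ℕ) : ℤ) = 2 * p - 1 - k by omega]
        push_cast
        ring
    rw [e1]
    push_cast
    rw [e2 p le_rfl]
    ring
  rw [slack, length_window, show ((3 * p - 1 : ℕ) : ℤ) = 3 * p - 1 by omega]
  zify at hcard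
  nlinarith

end Periodic

/-! ### Windows of minimal slack -/

/-- Every window of a bi-infinite word `x` of least period `p` has nonnegative slack, if this holds
for the windows that are not closed with period `p`. -/
theorem slack_window_nonneg {x : ℤ → α} {p : ℕ} (hp : 1 ≤ p) (hx : Function.Periodic x p)
    (hmin : ∀ g : ℕ, 1 ≤ g → Function.Periodic x g → p ≤ g)
    (hgood : ∀ a n, ¬ IsReturn (window x a n) p → 0 ≤ slack (window x a n)) (a : ℤ) (n : ℕ) :
    0 ≤ slack (window x a n) := by
  have tail_eq : ∀ (b : ℤ) (m : ℕ), slack (window x (b - 1) (m + 1)) =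
      slack (window x b m) + 2 * (m + 1) - 6 * numNew (window x (b - 1) (m + 1)) := by
    intro b m
    have hne : window x (b - 1) (m + 1) ≠ [] := List.length_pos_iff.1 (by simp)
    rw [slack_eq_tail hne, tail_window, length_window]
    simp
  have dropLast_eq : ∀ (b : ℤ) (m : ℕ), slack (window x b (m + 1)) =
      slack (window x b m) + 2 * (m + 1) - 6 * numNew (window x b (m + 1)).reverse := by
    intro b m
    have hne : window x b (m + 1) ≠ [] := List.length_pos_iff.1 (by simp)
    rw [slack_eq_dropLast hne, dropLast_window, length_window]
    simp
  -- The slack is bounded below, since it does not decrease once `3 p` is passed.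
  have hbdd : ∀ (m : ℕ) (b : ℤ), -(6 * p * min m (3 * p) : ℤ) ≤ slack (window x b m) := by
    intro m
    induction m with
    | zero =>
      intro b
      have := hgood b 0 fun ⟨m, hm, _, h, _⟩ => by rw [length_window] at h; omega
      simpa using this
    | succ m ih =>
      intro b
      by_cases h : IsReturn (window x b (m + 1)) p
      · have h1 := numNew_window_le_period hp hx h
        have h2 := tail_eq (b + 1) m
        rw [add_sub_cancel_right] at h2
        have h3 := ih (b + 1)
        zify at h1
        rcases le_or_gt (m + 1) (3 * p) with h4 | h4
        · rw [min_eq_left (by exact_mod_cast h4)]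
          rw [min_eq_left (by omega)] at h3
          push_cast
          nlinarith
        · rw [min_eq_right (by omega)]
          rw [min_eq_right (by omega)] at h3
          zify at h4
          nlinarith
      · refine le_trans ?_ (hgood b _ h)
        rw [neg_nonpos]
        positivity
  by_contra! hneg
  obtain ⟨μ, ⟨b, m, hbm⟩, hle⟩ := Int.exists_least_of_bdd
    (P := fun z => ∃ (b : ℤ) (m : ℕ), slack (window x b m) = z)
    ⟨-(6 * p * (3 * p) : ℤ), by
      rintro z ⟨b, m, rfl⟩
      have h1 : ((min m (3 * p) : ℕ) : ℤ) ≤ 3 * p := by exact_mod_cast min_le_right _ _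
      exact (neg_le_neg (mul_le_mul_of_nonneg_left h1 (by positivity))).trans (hbdd m b)⟩
    ⟨_, a, n, rfl⟩
  have hle : ∀ b m, μ ≤ slack (window x b m) := fun b m => hle _ ⟨b, m, rfl⟩
  have hμ : μ < 0 := (hle a n).trans_lt hneg
  have hret : ∀ b m, slack (window x b m) = μ → IsReturn (window x b m) p := by
    intro b m h
    by_contra hn
    have := hgood b m hn
    omega
  have hpos : ∀ b m, slack (window x b m) = μ → p < m := by
    intro b m h
    obtain ⟨l, hl, e, -⟩ := (isReturn_window_iff hp hx).1 (hret b m h)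
    omega
  -- At a minimum, neither deleting a letter nor extending periodically decreases the slack.
  have left_bounds : ∀ b m, slack (window x b m) = μ →
      m ≤ 3 * numNew (window x b m) ∧
      numNew (window x b m) ≤ numNew (window x (b - 1) (m + 1)) ∧
      3 * numNew (window x (b - 1) (m + 1)) ≤ m + 1 := by
    intro b m h
    refine ⟨?_, ((hret b m h).window_extend_left hp hx).2, ?_⟩
    · obtain ⟨m, rfl⟩ : ∃ m', m = m' + 1 := ⟨m - 1, by have := hpos b m h; omega⟩
      have h1 := tail_eq (b + 1) m
      rw [add_sub_cancel_right] at h1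
      have := hle (b + 1) m
      omega
    · have h1 := tail_eq b m
      have := hle (b - 1) (m + 1)
      omega
  have right_bounds : ∀ b m, slack (window x b m) = μ →
      m ≤ 3 * numNew (window x b m).reverse ∧
      numNew (window x b m).reverse ≤ numNew (window x b (m + 1)).reverse ∧
      3 * numNew (window x b (m + 1)).reverse ≤ m + 1 := by
    intro b m h
    refine ⟨?_, ((hret b m h).window_extend_right hp hx).2, ?_⟩
    · obtain ⟨m, rfl⟩ : ∃ m', m = m' + 1 := ⟨m - 1, by have := hpos b m h; omega⟩
      have h1 := dropLast_eq b m
      have := hle b m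
      omega
    · have h1 := dropLast_eq b m
      have := hle b (m + 1)
      omega
  have extend : ∀ b k, slack (window x b (3 * k - 1)) = μ →
      slack (window x (b - 1) (3 * k)) = μ := by
    intro b k h
    have h0 := hpos _ _ h
    obtain ⟨h1, h2, h3⟩ := left_bounds _ _ h
    have h4 := tail_eq b (3 * k - 1)
    rw [show 3 * k - 1 + 1 = 3 * k by omega] at *
    omega
  have shorten : ∀ b k, slack (window x b (3 * k)) = μ →
      slack (window x b (3 * k - 1)) = μ := by
    intro b k h
    have h0 := hpos _ _ h
    obtain ⟨h1, h2, h3⟩ := right_bounds _ _ h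
    have h4 := dropLast_eq b (3 * k - 1)
    rw [show 3 * k - 1 + 1 = 3 * k by omega] at *
    omega
  obtain ⟨b, k, hbk⟩ : ∃ b k, slack (window x b (3 * k)) = μ := by
    obtain ⟨h1, h2, h3⟩ := left_bounds _ _ hbm
    by_cases h : m = 3 * numNew (window x b m)
    · exact ⟨b, _, h ▸ hbm⟩
    · exact ⟨_, _, extend b (numNew (window x b m)) (by
        rwa [show 3 * numNew (window x b m) - 1 = m by omega])⟩
  have shift : ∀ j : ℕ, slack (window x (b - j) (3 * k)) = μ := by
    intro j
    induction j with
    | zero => simpa using hbk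
    | succ j ih =>
      have := extend _ _ (shorten _ _ ih)
      rwa [sub_sub, ← Nat.cast_succ] at this
  -- The two lengths pin down one and the same first return at every position.
  have hreturn : ∀ j : ℕ, firstReturn x (b - j) (3 * k - p - k) = k ∧ 1 ≤ 3 * k - p - k := by
    intro j
    obtain ⟨l, hl, e, hr⟩ := (isReturn_window_iff hp hx).1 (hret _ _ (shift j))
    obtain ⟨l', hl', e', hr'⟩ := (isReturn_window_iff hp hx).1 (hret _ _ (shorten _ _ (shift j)))
    obtain ⟨h1, h2, h3⟩ := left_bounds _ _ (shift j)
    obtain ⟨h1', h2', h3'⟩ := left_bounds _ _ (shorten _ _ (shift j))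
    have hk : numNew (window x (b - j) (p + l)) = k := by rw [← e]; omega
    have hk' : numNew (window x (b - j) (p + l')) = k := by rw [← e']; omega
    have hkl : k ≤ l' := by
      rw [← hk', numNew_window hp hx hr'.symm]
      exact (Finset.card_filter_le _ _).trans (by simp)
    have i1 := lt_add_firstReturn_iff hp hx hr.symm (m := 3 * k - p - k) (by omega) (by omega)
    have i2 := lt_add_firstReturn_iff hp hx hr'.symm (m := 3 * k - p - k) (by omega) (by omega)
    rw [hk] at i1
    rw [hk'] at i2
    omega
  have hper : Function.Periodic x k := by
    intro i
    -- `j` is chosen so that `b - j` is congruent to `i` modulo `p` and `j ≥ 0`.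
    set j := (b - i + p * |b - i|).toNat with hj
    have hj' : (j : ℤ) = b - i + p * |b - i| := by
      rw [hj, Int.toNat_of_nonneg]
      have := neg_abs_le (b - i)
      have := abs_nonneg (b - i)
      zify at hp
      nlinarith
    have h := (firstReturn_spec hp hx (b - j) (3 * k - p - k)).2 0 (hreturn j).2
    rw [(hreturn j).1, hj'] at h
    have e : ∀ i, x i = x (i - |b - i| * p) := fun i => (hx.sub_int_mul_eq _).symm
    have e' : ∀ i' c : ℤ, x (i' - c * p) = x i' := fun i' c => hx.sub_int_mul_eq _
    rw [← e' (i + k) |b - i|, ← e' i |b - i|]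
    convert h.symm using 2 <;> push_cast <;> ring
  have hpk : p = k := by
    refine le_antisymm (hmin k (by have := hpos _ _ hbk; omega) hper) ?_
    rw [← (hreturn 0).1]
    exact firstReturn_le_period hp hx _ _
  have := shorten _ _ hbk
  rw [← hpk] at this
  have := slack_window_nonneg_of_length_eq hp hx hmin b
  omega

/-- If the bound of `Good` fails for `numNew` in a window closed with period `p`, then extending the
window `s` letters to the left makes the slack negative. -/
theorem IsReturn.exists_slack_window_neg {x : ℤ → α} {p : ℕ} (hp : 1 ≤ p)
    (hx : Function.Periodic x p) (s : ℕ) {a : ℤ} {n : ℕ} (h : IsReturn (window x a n) p)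
    (hs : s + n + 1 ≤ 3 * numNew (window x a n)) (hlt : slack (window x a n) < s * (s + 1)) :
    ∃ b m, slack (window x b m) < 0 := by
  induction s generalizing a n with
  | zero => exact ⟨a, n, by simpa using hlt⟩
  | succ s ih =>
    obtain ⟨h1, h2⟩ := h.window_extend_left hp hx
    refine ih h1 (by omega) ?_
    have hne : window x (a - 1) (n + 1) ≠ [] := List.length_pos_iff.1 (by simp)
    rw [slack_eq_tail hne, tail_window, length_window, sub_add_cancel, Nat.add_sub_cancel]
    zify at h2 hs
    push_cast at hlt ⊢
    nlinarith

/-! ### All words are good -/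

theorem good_nil : Good ([] : List α) := by
  have h0 : numNew ([] : List α) = 0 := by
    have := clLong_eq ([] : List α)
    rw [List.tail_nil] at this
    omega
  have h1 : clLong ([] : List α) = 0 := by
    rw [clLong, Set.ncard_eq_zero (longClosedFactors_finite _), Set.eq_empty_iff_forall_notMem]
    intro v hv
    have := hv.2
    rw [List.infix_nil.1 hv.1.1] at this
    simp at this
  refine ⟨by simp [slack, h1], fun s hs => ?_⟩
  rw [List.reverse_nil, h0] at hs
  omega

/-- The periodic extension of a complete return; its shift is the least period of the extension. -/
theorem IsReturn.exists_periodic {w : List α} {p : ℕ} (h : IsReturn w p) :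
    ∃ x : ℤ → α, Function.Periodic x p ∧ window x 0 w.length = w ∧
      ∀ g : ℕ, 1 ≤ g → Function.Periodic x g → p ≤ g := by
  have hret := h
  obtain ⟨m, hm, hp, hlen, hb, -⟩ := h
  have hlt : ∀ i : ℤ, (i % p).toNat < w.length := fun i => by
    have := Int.emod_lt_of_pos i (show (0 : ℤ) < p by omega)
    omega
  set x : ℤ → α := fun i => w[(i % p).toNat]'(hlt i) with hxdef
  have hx : Function.Periodic x p := fun i => by simp [hxdef]
  have hmod : ∀ t < w.length, w[t % p]? = w[t]? := by
    intro t
    induction t using Nat.strong_induction_on with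
    | _ t ih =>
      intro ht
      rcases lt_or_ge t p with htp | htp
      · rw [Nat.mod_eq_of_lt htp]
      · rw [Nat.mod_eq_sub_mod htp, ih (t - p) (by omega) (by omega), hb (t - p) (by omega),
          Nat.add_sub_cancel' htp]
  have hw : window x 0 w.length = w := by
    apply List.ext_getElem?
    intro t
    rcases lt_or_ge t w.length with ht | ht
    · rw [getElem?_window _ _ ht, ← hmod t ht, hxdef, ← List.getElem?_eq_getElem]
      congr 1
      rw [zero_add, ← Int.natCast_mod, Int.toNat_natCast]
    · rw [List.getElem?_eq_none (by simpa), List.getElem?_eq_none ht]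
  refine ⟨x, hx, hw, fun g hg hxg => ?_⟩
  rw [← hw] at hret
  obtain ⟨l, -, -, hr⟩ := (isReturn_window_iff hp hx).1 hret
  rw [hr]
  exact firstReturn_le hg (agree_period hxg 0 l)

/-- A shortest word that is not good is closed; minimizing the period instead, among closed words
that are not good, leads to a contradiction within the periodic extension. -/
theorem good (w : List α) : Good w := by
  by_contra hbad
  have hex : ∃ q, ∃ w : List α, ¬ Good w ∧ IsReturn w q := by
    induction hn : w.length using Nat.strong_induction_on generalizing w with
    | _ n ih =>
      by_contra! hno
      have hne : w ≠ [] := fun h => hbad (h ▸ good_nil)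
      have hpos := List.length_pos_iff.2 hne
      have small : ∀ u : List α, u.length < n → Good u := by
        intro u hu
        by_contra hu'
        obtain ⟨q, v, h1, h2⟩ := ih _ hu u hu' rfl
        exact hno q v h1 h2
      exact hbad (good_of_not_isReturn hne (fun ⟨q, hq⟩ => hno q w hbad hq)
        (small _ (by rw [List.length_tail]; omega))
        (small _ (by rw [List.length_dropLast]; omega)))
  classical
  set p := Nat.find hex with hpdef
  obtain ⟨w, hwbad, hwp⟩ := Nat.find_spec hex
  rw [← hpdef] at hwp
  have hminp : ∀ (u : List α) (q : ℕ), IsReturn u q → q < p → Good u := by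
    intro u q hu hq
    by_contra hu'
    exact Nat.find_min hex hq ⟨u, hu', hu⟩
  clear_value p
  wlog hk : numNew w.reverse ≤ numNew w generalizing w
  · exact this w.reverse (fun h => hwbad (by simpa using h.reverse)) hwp.reverse
      (by simpa using (not_le.1 hk).le)
  have hp : 1 ≤ p := hwp.choose_spec.2.1
  obtain ⟨x, hx, hw, hmin⟩ := hwp.exists_periodic
  have hgood : ∀ (n : ℕ) (a : ℤ), ¬ IsReturn (window x a n) p → Good (window x a n) := by
    intro n
    induction n with
    | zero => exact fun a _ => good_nil
    | succ n ih =>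
      intro a ha
      by_cases hr : ∃ q, IsReturn (window x a (n + 1)) q
      · obtain ⟨q, hq⟩ := hr
        obtain ⟨m, -, -, hqm⟩ := (isReturn_window_iff hp hx).1 hq
        refine hminp _ q hq (lt_of_le_of_ne (hqm ▸ firstReturn_le_period hp hx a m) ?_)
        rintro rfl
        exact ha hq
      · refine good_of_not_isReturn (List.length_pos_iff.1 (by simp)) hr ?_ ?_
        · rw [tail_window]
          refine ih (a + 1) fun h => ha ?_
          simpa using (h.window_extend_left hp hx).1
        · rw [dropLast_window]
          exact ih a fun h => ha (h.window_extend_right hp hx).1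
  have hall := slack_window_nonneg hp hx hmin fun a n h => (hgood n a h).1
  have hret : IsReturn (window x 0 w.length) p := by rwa [hw]
  refine hwbad ⟨hw ▸ hall 0 w.length, fun s hs => ?_⟩
  by_contra! hlt
  rw [max_eq_left hk] at hs
  obtain ⟨b, m, hbm⟩ := hret.exists_slack_window_neg hp hx s (by rwa [hw]) (by rwa [hw])
  exact absurd (hall b m) (not_le.2 hbm)

/-- The short closed factors are the empty word and the letters. -/
theorem cl_le_clLong (w : List α) : cl w ≤ clLong w + w.length + 1 := by
  classical
  have hsub : closedFactors w ⊆
      longClosedFactors w ∪ (insert [] (w.toFinset.image fun a => [a]) : Finset (List α)) := by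
    intro v hv
    rcases lt_or_ge v.length 2 with h | h
    · right
      match v, h with
      | [], _ => simp
      | [a], _ =>
        have := hv.1.subset (List.mem_singleton_self a)
        simpa using this
    · exact Or.inl ⟨hv, h⟩
  have h1 := Set.ncard_le_ncard hsub
    ((longClosedFactors_finite w).union (Finset.finite_toSet _))
  have h2 := Set.ncard_union_le (longClosedFactors w)
    (insert [] (w.toFinset.image fun a => [a]) : Finset (List α))
  rw [Set.ncard_coe_finset] at h2
  have h3 := Finset.card_insert_le [] (w.toFinset.image fun a => [a])
  have h4 := (Finset.card_image_le (s := w.toFinset) (f := fun a => [a])).trans w.toFinset_card_le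
  unfold cl clLong
  omega

end ClosedWords

theorem theorem1 {α : Type*} (w : List α) (n : ℕ) (hn : w.length = n) :
    (ClosedWords.clLong w : ℝ) ≤ (n : ℝ) ^ 2 / 6 + (n : ℝ) / 6 ∧
      (ClosedWords.cl w : ℝ) ≤ (n : ℝ) ^ 2 / 6 + 7 * (n : ℝ) / 6 + 1 := by
  have h1 : (6 * ClosedWords.clLong w : ℤ) ≤ n * (n + 1) := by
    have := (ClosedWords.good w).1
    rw [ClosedWords.slack, hn] at this
    linarith
  have h1' : (6 * ClosedWords.clLong w : ℝ) ≤ n * (n + 1) := by exact_mod_cast h1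
  have h2 := ClosedWords.cl_le_clLong w
  rw [hn] at h2
  have h2' : (ClosedWords.cl w : ℝ) ≤ ClosedWords.clLong w + n + 1 := by exact_mod_cast h2
  constructor <;> nlinarith
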